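/- Let $(\mathcal{B},\mathbb{E},\mathfrak{s})$ be an extriangulated category (in the sense of Nakaoka–Palu) satisfying Condition (WIC): if $gf$ is an inflation then so is $f$, and if $gf$ is a deflation then so is $g$. For a class $\mathcal{Y}$ of objects put ${}^\perp\mathcal{Y}=\{Z\mid \mathbb{E}(Z,Y)=0\ \forall\, Y\in\mathcal{Y}\}$ and $\mathcal{Y}^\perp=\{Z\mid \mathbb{E}(Y,Z)=0\ \forall\, Y\in\mathcal{Y}\}$. A pair $(\mathcal{X},\mathcal{Y})$ is a *complete cotorsion pair* if $\mathcal{X}^\perp=\mathcal{Y}$, ${}^\perp\mathcal{Y}=\mathcal{X}$ and for every object $A$ there are conflations $Y\to X\to A$ and $A\to Y'\to X'$ with $X,X'\in\mathcal{X}$ and $Y,Y'\in\mathcal{Y}$; it is *hereditary* if $\mathcal{X}$ is closed under cocones of deflations and $\mathcal{Y}$ is closed under cones of inflations. A triple $(\mathcal{C},\mathcal{W},\mathcal{F})$ of classes of objects is a *hereditary Hovey triple* if $(\mathcal{C}\cap\mathcal{W},\mathcal{F})$ and $(\mathcal{C},\mathcal{W}\cap\mathcal{F})$ are complete hereditary cotorsion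 pairs and $\mathcal{W}$ is closed under direct summands and has the two-out-of-three property for conflations. For $n\ge 0$ let $\mathcal{Y}_n$ be the class of objects of $\mathcal{Y}$-coresolution dimension at most $n$, that is, of objects $B$ admitting a finite coresolution $0\to B\to Y_0\to Y_{-1}\to\cdots\to Y_{-n}\to 0$ with all $Y_{-k}\in\mathcal{Y}$, obtained by splicing conflations $B\to Y_0\to Z_0$ and $Z_{-k}\to Y_{-k-1}\to Z_{-k-1}$ $(k\ge 0)$ with $Y_{-k}=0$ for $k>n$ and $Z_{-k}=0$ for $k\ge n$. Let $\mathcal{Y}_{-1}$ be the class of zero objects. Write ${}^\perp\mathcal{Y}_n$ for ${}^\perp(\mathcal{Y}_n)$. **Theorem 3.2.** Let $(\mathcal{C},\mathcal{W},\mathcal{F})$ be a hereditary Hovey triple in $\mathcal{B}$. For an object $M\in\mathcal{B}$ and an integer $n\ge 0$ consider the following conditions: (1) $M\in\mathcal{F}_n$; (2) there is a conflation $N\to L\to M$ with $N\in\mathcal{F}$ and $L\in(\mathcal{W}\cap\mathcal{F})_n$; (3) there is a conflation $M\to F\to K$ with $F\in\mathcal{F}$ and $K\in(\mathcal{W}\cap\mathcal{F})_{n-1}$;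 (4) $\mathbb{E}(H,M)=0$ for every $H\in{}^\perp(\mathcal{W}\cap\mathcal{F})_n\cap\mathcal{W}$. Then $(1)\Leftrightarrow(2)\Leftrightarrow(3)\Rightarrow(4)$. If moreover $({}^\perp(\mathcal{W}\cap\mathcal{F})_n,(\mathcal{W}\cap\mathcal{F})_n)$ is a complete cotorsion pair, then also $(4)\Rightarrow(1)$. -/

import Mathlib

open CategoryTheory CategoryTheory.Limits Opposite

universe w v u

namespace Extri

section Sequences

variable {B : Type u} [Category.{v} B]

/-- A sequence `A ⟶ X ⟶ C` with fixed end terms. -/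
structure Seq (A C : B) where
  mid : B
  inc : A ⟶ mid
  proj : mid ⟶ C

/-- Two sequences `A ⟶ X ⟶ C` and `A ⟶ X' ⟶ C` are equivalent if there is an isomorphism
`X ≅ X'` inducing the identity on `A` and on `C`. -/
instance seqSetoid (A C : B) : Setoid (Seq A C) where
  r S T := ∃ b : S.mid ≅ T.mid, S.inc ≫ b.hom = T.inc ∧ b.hom ≫ T.proj = S.proj
  iseqv :=
    { refl := fun S => ⟨Iso.refl _, by simp, by simp⟩
      symm := by
        rintro S T ⟨b, h₁, h₂⟩
        exact ⟨b.symm, by simp [← h₁], by simp [← h₂]⟩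
      trans := by
        rintro S T U ⟨b, h₁, h₂⟩ ⟨c, h₃, h₄⟩
        exact ⟨b ≪≫ c, by simp [← h₃, ← h₁], by simp [h₄, h₂]⟩ }

/-- The equivalence class `[A ⟶ X ⟶ C]`. -/
def seqClass {A X C : B} (x : A ⟶ X) (y : X ⟶ C) : Quotient (seqSetoid A C) :=
  Quotient.mk (seqSetoid A C) ⟨X, x, y⟩

end Sequences

section Extensions

variable {B : Type u} [Category.{v} B]

/-- The group `𝔼(C, A)` of `𝔼`-extensions. -/
abbrev Ext (E : Bᵒᵖ ⥤ B ⥤ AddCommGrpCat.{w}) (C A : B) : Type w :=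
  (E.obj (op C)).obj A

/-- The extension `a_* δ`. -/
def push (E : Bᵒᵖ ⥤ B ⥤ AddCommGrpCat.{w}) {C A A' : B} (a : A ⟶ A') (δ : Ext E C A) :
    Ext E C A' :=
  (E.obj (op C)).map a δ

/-- The extension `c^* δ`. -/
def pull (E : Bᵒᵖ ⥤ B ⥤ AddCommGrpCat.{w}) {C C' A : B} (c : C' ⟶ C) (δ : Ext E C A) :
    Ext E C' A :=
  (E.map c.op).app A δ

/-- A correspondence assigning to every `δ ∈ 𝔼(C, A)` an equivalence class of sequences
`A ⟶ X ⟶ C`. -/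
abbrev Correspondence (E : Bᵒᵖ ⥤ B ⥤ AddCommGrpCat.{w}) : Type (max u v w) :=
  ∀ (C A : B), Ext E C A → Quotient (seqSetoid A C)

variable {E : Bᵒᵖ ⥤ B ⥤ AddCommGrpCat.{w}}

/-- `A ⟶ X ⟶ C ⇢ δ` is an `𝔼`-triangle: the sequence realizes `δ`. -/
def IsTriangle (s : Correspondence E) {A X C : B} (x : A ⟶ X) (y : X ⟶ C) (δ : Ext E C A) :
    Prop :=
  s C A δ = seqClass x y

/-- `A ⟶ X ⟶ C` is a conflation. -/
def IsConflation (s : Correspondence E) {A X C : B} (x : A ⟶ X) (y : X ⟶ C) : Prop :=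
  ∃ δ : Ext E C A, IsTriangle s x y δ

/-- There is an `𝔼`-triangle with the given objects. -/
def ExistsTriangle (s : Correspondence E) (A X C : B) : Prop :=
  ∃ (x : A ⟶ X) (y : X ⟶ C) (δ : Ext E C A), IsTriangle s x y δ

def IsInflation (s : Correspondence E) {A X : B} (x : A ⟶ X) : Prop :=
  ∃ (C : B) (y : X ⟶ C), IsConflation s x y

def IsDeflation (s : Correspondence E) {X C : B} (y : X ⟶ C) : Prop :=
  ∃ (A : B) (x : A ⟶ X), IsConflation s x y

/-- Condition (WIC). -/
structure IsWIC (s : Correspondence E) : Prop where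
  inflation_of_comp : ∀ {X Y Z : B} (f : X ⟶ Y) (g : Y ⟶ Z),
    IsInflation s (f ≫ g) → IsInflation s f
  deflation_of_comp : ∀ {X Y Z : B} (f : X ⟶ Y) (g : Y ⟶ Z),
    IsDeflation s (f ≫ g) → IsDeflation s g

end Extensions

section Extriangulated

variable {B : Type u} [Category.{v} B] [Preadditive B] [HasZeroObject B] [HasBinaryBiproducts B]

/-- The extension `δ ⊕ δ' ∈ 𝔼(C ⊕ C', A ⊕ A')`, whose components are `(δ, 0, 0, δ')`. -/
noncomputable def extSum (E : Bᵒᵖ ⥤ B ⥤ AddCommGrpCat.{w}) {C A C' A' : B}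
    (δ : Ext E C A) (δ' : Ext E C' A') : Ext E (C ⊞ C') (A ⊞ A') :=
  pull E biprod.fst (push E biprod.inl δ) + pull E biprod.snd (push E biprod.inr δ')

/-- `(B, 𝔼, 𝔰)` is an extriangulated category in the sense of Nakaoka and Palu. -/
structure IsExtriangulated (E : Bᵒᵖ ⥤ B ⥤ AddCommGrpCat.{w}) (s : Correspondence E) :
    Prop where
  /-- (ET1), additivity in the contravariant variable. -/
  additive_left : E.Additive
  /-- (ET1), additivity in the covariant variable. -/
  additive_right : ∀ C : Bᵒᵖ, (E.obj C).Additive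
  /-- (ET2), `𝔰` is a realization. -/
  realization : ∀ {A X C A' X' C' : B} {x : A ⟶ X} {y : X ⟶ C} {δ : Ext E C A}
    {x' : A' ⟶ X'} {y' : X' ⟶ C'} {δ' : Ext E C' A'},
    IsTriangle s x y δ → IsTriangle s x' y' δ' →
    ∀ (a : A ⟶ A') (c : C ⟶ C'), push E a δ = pull E c δ' →
      ∃ b : X ⟶ X', x ≫ b = a ≫ x' ∧ y ≫ c = b ≫ y'
  /-- (ET2), the zero extension is realized by the split sequence. -/
  split : ∀ A C : B,
    IsTriangle s (biprod.inl : A ⟶ A ⊞ C) (biprod.snd : A ⊞ C ⟶ C) (0 : Ext E C A)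
  /-- (ET2), `𝔰 (δ ⊕ δ') = 𝔰 δ ⊕ 𝔰 δ'`. -/
  sum : ∀ {A X C A' X' C' : B} {x : A ⟶ X} {y : X ⟶ C} {δ : Ext E C A}
    {x' : A' ⟶ X'} {y' : X' ⟶ C'} {δ' : Ext E C' A'},
    IsTriangle s x y δ → IsTriangle s x' y' δ' →
    IsTriangle s (biprod.map x x') (biprod.map y y') (extSum E δ δ')
  /-- (ET3) -/
  et3 : ∀ {A X C A' X' C' : B} {x : A ⟶ X} {y : X ⟶ C} {δ : Ext E C A}
    {x' : A' ⟶ X'} {y' : X' ⟶ C'} {δ' : Ext E C' A'},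
    IsTriangle s x y δ → IsTriangle s x' y' δ' →
    ∀ (a : A ⟶ A') (b : X ⟶ X'), x ≫ b = a ≫ x' →
      ∃ c : C ⟶ C', y ≫ c = b ≫ y' ∧ push E a δ = pull E c δ'
  /-- (ET3)ᵒᵖ -/
  et3_op : ∀ {A X C A' X' C' : B} {x : A ⟶ X} {y : X ⟶ C} {δ : Ext E C A}
    {x' : A' ⟶ X'} {y' : X' ⟶ C'} {δ' : Ext E C' A'},
    IsTriangle s x y δ → IsTriangle s x' y' δ' →
    ∀ (b : X ⟶ X') (c : C ⟶ C'), y ≫ c = b ≫ y' →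
      ∃ a : A ⟶ A', x ≫ b = a ≫ x' ∧ push E a δ = pull E c δ'
  /-- (ET4) -/
  et4 : ∀ {A X D Y G : B} {f : A ⟶ X} {f' : X ⟶ D} {δ : Ext E D A}
    {g : X ⟶ Y} {g' : Y ⟶ G} {δ' : Ext E G X},
    IsTriangle s f f' δ → IsTriangle s g g' δ' →
    ∃ (H : B) (h' : Y ⟶ H) (d : D ⟶ H) (e : H ⟶ G) (δ'' : Ext E H A),
      f' ≫ d = g ≫ h' ∧ h' ≫ e = g' ∧
      IsTriangle s (f ≫ g) h' δ'' ∧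
      IsTriangle s d e (push E f' δ') ∧
      pull E d δ'' = δ ∧
      push E f δ'' = pull E e δ'
  /-- (ET4)ᵒᵖ -/
  et4_op : ∀ {D Y X G C : B} {f' : D ⟶ Y} {f : Y ⟶ X} {δ : Ext E X D}
    {g' : G ⟶ X} {g : X ⟶ C} {δ' : Ext E C G},
    IsTriangle s f' f δ → IsTriangle s g' g δ' →
    ∃ (H : B) (h' : H ⟶ Y) (d : D ⟶ H) (e : H ⟶ G) (δ'' : Ext E C H),
      e ≫ g' = h' ≫ f ∧ d ≫ h' = f' ∧
      IsTriangle s h' (f ≫ g) δ'' ∧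
      IsTriangle s d e (pull E g' δ) ∧
      push E e δ'' = δ' ∧
      push E d δ = pull E g δ''

/-- `X` is a direct summand of `Y`. -/
def IsDirectSummand (X Y : B) : Prop :=
  ∃ X' : B, Nonempty (Y ≅ X ⊞ X')

end Extriangulated

section Cotorsion

variable {B : Type u} [Category.{v} B] {E : Bᵒᵖ ⥤ B ⥤ AddCommGrpCat.{w}}

/-- `𝒳^⊥` -/
def rightPerp (E : Bᵒᵖ ⥤ B ⥤ AddCommGrpCat.{w}) (P : ObjectProperty B) : ObjectProperty B :=
  fun Z => ∀ X : B, P X → ∀ δ : Ext E X Z, δ = 0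

/-- `^⊥𝒴` -/
def leftPerp (E : Bᵒᵖ ⥤ B ⥤ AddCommGrpCat.{w}) (Q : ObjectProperty B) : ObjectProperty B :=
  fun Z => ∀ Y : B, Q Y → ∀ δ : Ext E Z Y, δ = 0

structure IsCompleteCotorsionPair (s : Correspondence E) (P Q : ObjectProperty B) : Prop where
  rightPerp_eq : rightPerp E P = Q
  leftPerp_eq : leftPerp E Q = P
  precover : ∀ C : B, ∃ Y X : B, Q Y ∧ P X ∧ ExistsTriangle s Y X C
  preenvelope : ∀ C : B, ∃ Y X : B, Q Y ∧ P X ∧ ExistsTriangle s C Y X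

def ClosedUnderCocones (s : Correspondence E) (P : ObjectProperty B) : Prop :=
  ∀ A X C : B, ExistsTriangle s A X C → P X → P C → P A

def ClosedUnderCones (s : Correspondence E) (P : ObjectProperty B) : Prop :=
  ∀ A X C : B, ExistsTriangle s A X C → P A → P X → P C

def ClosedUnderExtensions (s : Correspondence E) (P : ObjectProperty B) : Prop :=
  ∀ A X C : B, ExistsTriangle s A X C → P A → P C → P X

/-- The heredity condition on a cotorsion pair. -/
structure IsHereditary (s : Correspondence E) (P Q : ObjectProperty B) : Prop where
  cocones : ClosedUnderCocones s P
  cones : ClosedUnderCones s Q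

structure IsThick [Preadditive B] [HasZeroObject B] [HasBinaryBiproducts B] (s : Correspondence E)
    (W : ObjectProperty B) : Prop where
  summand : ∀ X Y : B, IsDirectSummand X Y → W Y → W X
  cocones : ClosedUnderCocones s W
  cones : ClosedUnderCones s W
  extensions : ClosedUnderExtensions s W

/-- `(𝒞, 𝒲, ℱ)` is a Hovey triple. -/
structure IsHoveyTriple [Preadditive B] [HasZeroObject B] [HasBinaryBiproducts B] (s : Correspondence E)
    (C W F : ObjectProperty B) : Prop where
  trivCof : IsCompleteCotorsionPair s (C ⊓ W) F
  trivFib : IsCompleteCotorsionPair s C (W ⊓ F)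
  thick : IsThick s W

structure IsHereditaryHoveyTriple [Preadditive B] [HasZeroObject B] [HasBinaryBiproducts B]
    (s : Correspondence E) (C W F : ObjectProperty B) : Prop
    extends IsHoveyTriple s C W F where
  hereditary_trivCof : IsHereditary s (C ⊓ W) F
  hereditary_trivFib : IsHereditary s C (W ⊓ F)

end Cotorsion

section Coresolution

variable {B : Type u} [Category.{v} B] {E : Bᵒᵖ ⥤ B ⥤ AddCommGrpCat.{w}}

/-- A `𝒴`-coresolution `0 ⟶ M ⟶ Y₀ ⟶ Y₋₁ ⟶ ⋯` of `M`, given by its `𝔼`-triangles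
`M ⟶ Y₀ ⟶ Z₀` and `Z₋ₖ ⟶ Y₋ₖ₋₁ ⟶ Z₋ₖ₋₁`; here `Y k` and `Z k` stand for `Y₋ₖ` and `Z₋ₖ`,
and the differentials are the composites `proj k ≫ inc k`. -/
structure Coresolution (s : Correspondence E) (Q : ObjectProperty B) (M : B) where
  Y : ℕ → B
  Z : ℕ → B
  mem : ∀ k, Q (Y k)
  aug : M ⟶ Y 0
  proj : ∀ k, Y k ⟶ Z k
  inc : ∀ k, Z k ⟶ Y (k + 1)
  conflation_zero : IsConflation s aug (proj 0)
  conflation_succ : ∀ k, IsConflation s (inc k) (proj (k + 1))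

/-- The coresolution has the form `0 ⟶ M ⟶ Y₀ ⟶ ⋯ ⟶ Y₋ₙ ⟶ 0`: its terms beyond `Y₋ₙ` and its
cycles from `Z₋ₙ` on vanish (the vanishing of the terms alone would not force `Z₋ₙ = 0`, as
`Z ⟶ 0 ⟶ Z⟦1⟧` is a conflation in a triangulated category). -/
structure Coresolution.HasLength {s : Correspondence E} {Q : ObjectProperty B} {M : B}
    (R : Coresolution s Q M) (n : ℕ) : Prop where
  isZero_term : ∀ k, n < k → IsZero (R.Y k)
  isZero_cycle : ∀ k, n ≤ k → IsZero (R.Z k)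

/-- The `𝒴`-coresolution dimension: the least length of a finite `𝒴`-coresolution, and `∞` if
there is none. -/
noncomputable def coresDim (s : Correspondence E) (Q : ObjectProperty B) (M : B) : ℕ∞ :=
  sInf {d : ℕ∞ | ∃ n : ℕ, d = n ∧ ∃ R : Coresolution s Q M, R.HasLength n}

/-- `𝒴ₙ`, the objects of `𝒴`-coresolution dimension at most `n`. -/
def coresDimLE (s : Correspondence E) (Q : ObjectProperty B) (n : ℕ) : ObjectProperty B :=
  fun M => coresDim s Q M ≤ n

/-- `𝒴ₙ₋₁`, where `𝒴₋₁` consists of the zero objects. -/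
def coresDimLEPred (s : Correspondence E) (Q : ObjectProperty B) : ℕ → ObjectProperty B
  | 0 => fun M => IsZero M
  | n + 1 => coresDimLE s Q n

theorem coresDimLE_iff (s : Correspondence E) (Q : ObjectProperty B) (n : ℕ) (M : B) :
    coresDimLE s Q n M ↔ ∃ R : Coresolution s Q M, R.HasLength n := by
  constructor
  · intro h
    have h₁ : sInf {d : ℕ∞ | ∃ n : ℕ, d = n ∧ ∃ R : Coresolution s Q M, R.HasLength n} ≤ n := h
    have hne : {d : ℕ∞ | ∃ n : ℕ, d = n ∧ ∃ R : Coresolution s Q M, R.HasLength n}.Nonempty := by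
      by_contra hc
      rw [Set.not_nonempty_iff_eq_empty] at hc
      rw [hc, sInf_empty] at h₁
      exact absurd h₁ (by simp)
    obtain ⟨m, hm, R, hR⟩ := csInf_mem hne
    rw [hm] at h₁
    have hmn : m ≤ n := by exact_mod_cast h₁
    exact ⟨R, fun k hk => hR.isZero_term k (by omega), fun k hk => hR.isZero_cycle k (by omega)⟩
  · rintro ⟨R, hR⟩
    exact sInf_le ⟨n, rfl, R, hR⟩

end Coresolution

end Extri

namespace Extri

/-! ### Functoriality of extensions and uniqueness of realizations. -/

section Functoriality

variable {B : Type u} [Category.{v} B] {E : Bᵒᵖ ⥤ B ⥤ AddCommGrpCat.{w}}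

/-! Conditions (2) and (3) are exchanged by (ET4) and its dual. A conflation N → L → M is composed
with the first step L → Y → K of a coresolution of L, and heredity puts the cone of N → Y in ℱ;
conversely, the middle term of (3) is resolved by an object of 𝒲 ∩ ℱ. That (1) gives (3) is an
induction on n: M → Y → Z is pulled back along a resolution L → Z as in (2).

For (4), the map 𝔼(H, L) → 𝔼(H, M) is onto, because "second extensions" of H ∈ 𝒞 ∩ 𝒲 by N ∈ ℱ
vanish. `exists_lift_ext` expresses this without higher extension groups.

For the converse, M is covered by X ∈ 𝒞 ∩ 𝒲 with cocone in ℱ, and X is embedded in some L ∈ (𝒲 ∩ ℱ)ₙ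
with cone U. Then M embeds with the same cone U in some P ∈ ℱₙ, and this embedding splits since U ∈
𝒲. It remains that ℱₙ is closed under summands, the technical core:
`coresDimLE_summand_and_extension`. -/

theorem push_id {C A : B} (δ : Ext E C A) : push E (𝟙 A) δ = δ := by
  simp [push]

theorem pull_id {C A : B} (δ : Ext E C A) : pull E (𝟙 C) δ = δ := by
  simp [pull]

theorem push_comp {C A A' A'' : B} (a : A ⟶ A') (a' : A' ⟶ A'') (δ : Ext E C A) :
    push E (a ≫ a') δ = push E a' (push E a δ) := by
  simp [push]

theorem pull_comp {C C' C'' A : B} (c : C' ⟶ C) (c' : C'' ⟶ C') (δ : Ext E C A) :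
    pull E (c' ≫ c) δ = pull E c' (pull E c δ) := by
  simp [pull]

theorem push_pull {C C' A A' : B} (a : A ⟶ A') (c : C' ⟶ C) (δ : Ext E C A) :
    push E a (pull E c δ) = pull E c (push E a δ) := by
  simp only [push, pull]
  exact (ConcreteCategory.congr_hom ((E.map c.op).naturality a) δ).symm

theorem push_add {C A A' : B} (a : A ⟶ A') (δ ε : Ext E C A) :
    push E a (δ + ε) = push E a δ + push E a ε :=
  map_add ((E.obj (op C)).map a).hom δ ε

theorem pull_add {C C' A : B} (c : C' ⟶ C) (δ ε : Ext E C A) :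
    pull E c (δ + ε) = pull E c δ + pull E c ε :=
  map_add ((E.map c.op).app A).hom δ ε

theorem push_zero {C A A' : B} (a : A ⟶ A') : push E a (0 : Ext E C A) = 0 :=
  map_zero ((E.obj (op C)).map a).hom

theorem pull_zero {C C' A : B} (c : C' ⟶ C) : pull E c (0 : Ext E C A) = 0 :=
  map_zero ((E.map c.op).app A).hom

theorem rightPerp_of_retract {P : ObjectProperty B} {M N : B} (i : M ⟶ N) (r : N ⟶ M)
    (h : i ≫ r = 𝟙 M) (hN : rightPerp E P N) : rightPerp E P M := fun X hX δ => by
  rw [← push_id δ, ← h, push_comp, hN X hX (push E i δ), push_zero]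

end Functoriality

section Realization

variable {B : Type u} [Category.{v} B] {E : Bᵒᵖ ⥤ B ⥤ AddCommGrpCat.{w}} {s : Correspondence E}

theorem exists_isTriangle (s : Correspondence E) {A C : B} (δ : Ext E C A) :
    ∃ (X : B) (x : A ⟶ X) (y : X ⟶ C), IsTriangle s x y δ := by
  obtain ⟨⟨X, x, y⟩, h⟩ := Quotient.exists_rep (s C A δ)
  exact ⟨X, x, y, h.symm⟩

theorem IsTriangle.exists_iso {A X X' C : B} {x : A ⟶ X} {y : X ⟶ C} {x' : A ⟶ X'} {y' : X' ⟶ C}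
    {δ : Ext E C A} (h : IsTriangle s x y δ) (h' : IsTriangle s x' y' δ) :
    ∃ b : X ≅ X', x ≫ b.hom = x' ∧ b.hom ≫ y' = y :=
  Quotient.exact (h.symm.trans h')

theorem IsTriangle.of_iso_mid {A X X' C : B} {x : A ⟶ X} {y : X ⟶ C} {δ : Ext E C A}
    (h : IsTriangle s x y δ) (b : X ≅ X') : IsTriangle s (x ≫ b.hom) (b.inv ≫ y) δ :=
  h.trans (Quotient.sound ⟨b, rfl, by simp⟩)

end Realization

/-! ### Exactness, change of triangles by isomorphisms, pullbacks and pushouts. -/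

namespace IsExtriangulated

variable {B : Type u} [Category.{v} B] [Preadditive B] [HasBinaryBiproducts B]
  {E : Bᵒᵖ ⥤ B ⥤ AddCommGrpCat.{w}} {s : Correspondence E}

theorem zero_push (hB : IsExtriangulated E s) {C A A' : B} (δ : Ext E C A) :
    push E (0 : A ⟶ A') δ = 0 := by
  have := hB.additive_right (op C)
  simp [push]

theorem zero_pull (hB : IsExtriangulated E s) {C C' A : B} (δ : Ext E C A) :
    pull E (0 : C' ⟶ C) δ = 0 := by
  have := hB.additive_left
  simp [pull]

theorem add_pull (hB : IsExtriangulated E s) {C C' A : B} (c d : C' ⟶ C) (δ : Ext E C A) :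
    pull E (c + d) δ = pull E c δ + pull E d δ := by
  have := hB.additive_left
  simp [pull]

theorem eq_zero_of_isZero_right (hB : IsExtriangulated E s) {C A : B} (hA : IsZero A)
    (δ : Ext E C A) : δ = 0 := by
  rw [← push_id δ, hA.eq_of_src (𝟙 A) 0, hB.zero_push]

theorem exists_lift (hB : IsExtriangulated E s) {A X C T : B} {x : A ⟶ X} {y : X ⟶ C}
    {δ : Ext E C A} (h : IsTriangle s x y δ) (f : T ⟶ C) (hf : pull E f δ = 0) :
    ∃ g : T ⟶ X, g ≫ y = f := by
  obtain ⟨b, -, hb⟩ := hB.realization (hB.split A T) h (𝟙 A) f (by rw [hf, push_zero])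
  exact ⟨biprod.inr ≫ b, by rw [Category.assoc, ← hb]; simp⟩

theorem exists_pull_eq (hB : IsExtriangulated E s) {A X C T : B} {x : A ⟶ X} {y : X ⟶ C}
    {δ : Ext E C A} (h : IsTriangle s x y δ) (η : Ext E T A) (hη : push E x η = 0) :
    ∃ c : T ⟶ C, pull E c δ = η := by
  obtain ⟨G, i, p, hG⟩ := exists_isTriangle s η
  obtain ⟨b, hb, -⟩ := hB.realization hG (hB.split X T) x (𝟙 T) (by rw [hη, pull_zero])
  obtain ⟨c, -, hc⟩ := hB.et3 hG h (𝟙 A) (b ≫ biprod.fst) (by rw [← Category.assoc, hb]; simp)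
  exact ⟨c, by rw [← hc, push_id]⟩

/-- Exactness at 𝔼(T, X). By (ET4) the extension `push E y ξ` is realized by a sequence C → H → T;
as it vanishes, H → T has a section, along which the extension of H by A from (ET4) is pulled back.
-/
theorem exists_push_eq (hB : IsExtriangulated E s) {A X C T : B} {x : A ⟶ X} {y : X ⟶ C}
    {δ : Ext E C A} (h : IsTriangle s x y δ) (ξ : Ext E T X) (hξ : push E y ξ = 0) :
    ∃ η : Ext E T A, push E x η = ξ := by
  obtain ⟨G, i, p, hG⟩ := exists_isTriangle s ξ
  obtain ⟨H, h', d, e, δ', -, -, -, he, -, hδ⟩ := hB.et4 h hG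
  obtain ⟨t, ht⟩ := hB.exists_lift he (𝟙 T) (by rw [hξ, pull_zero])
  exact ⟨pull E t δ', by rw [push_pull, hδ, ← pull_comp, ht, pull_id]⟩

theorem rightPerp_extension (hB : IsExtriangulated E s) (P : ObjectProperty B) :
    ClosedUnderExtensions s (rightPerp E P) := by
  rintro A X C ⟨x, y, δ, h⟩ hA hC T hT ξ
  obtain ⟨η, rfl⟩ := hB.exists_push_eq h ξ (hC T hT _)
  rw [hA T hT η, push_zero]

theorem rightPerp_of_isZero (hB : IsExtriangulated E s) (P : ObjectProperty B) {Z : B}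
    (hZ : IsZero Z) : rightPerp E P Z := fun _ _ δ => hB.eq_zero_of_isZero_right hZ δ

theorem rightPerp_biprod (hB : IsExtriangulated E s) {P : ObjectProperty B} {X Y : B}
    (hX : rightPerp E P X) (hY : rightPerp E P Y) : rightPerp E P (X ⊞ Y) :=
  hB.rightPerp_extension P _ _ _ ⟨_, _, _, hB.split X Y⟩ hX hY

theorem leftPerp_biprod (hB : IsExtriangulated E s) {Q : ObjectProperty B} {X Y : B}
    (hX : leftPerp E Q X) (hY : leftPerp E Q Y) : leftPerp E Q (X ⊞ Y) := fun T hT δ => by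
  rw [← pull_id δ, ← biprod.total, hB.add_pull, pull_comp, pull_comp,
    hX T hT (pull E biprod.inl δ), hY T hT (pull E biprod.inr δ), pull_zero, pull_zero, add_zero]

/-- The sequence `A = A ⟶ 0`. -/
theorem existsTriangle_zero (hB : IsExtriangulated E s) (A : B) {Z : B} (hZ : IsZero Z) :
    ExistsTriangle s A A Z :=
  ⟨_, _, _, (hB.split A Z).of_iso_mid
    { hom := biprod.fst
      inv := biprod.inl
      hom_inv_id := by
        ext
        · simp
        · simp
        · exact hZ.eq_of_src _ _
        · exact hZ.eq_of_src _ _ }⟩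

theorem exists_iso_biprod (hB : IsExtriangulated E s) {A X C : B} {x : A ⟶ X} {y : X ⟶ C}
    (h : IsTriangle s x y (0 : Ext E C A)) : Nonempty (X ≅ A ⊞ C) :=
  let ⟨b, _⟩ := h.exists_iso (hB.split A C)
  ⟨b⟩

theorem exists_factor (hB : IsExtriangulated E s) {A X C T : B} {x : A ⟶ X} {y : X ⟶ C}
    {δ : Ext E C A} (h : IsTriangle s x y δ) (f : T ⟶ X) (hf : f ≫ y = 0) :
    ∃ u : T ⟶ A, u ≫ x = f := by
  obtain ⟨u, hu, -⟩ := hB.et3_op (hB.split T T) h (biprod.fst ≫ f) 0 (by simp [hf])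
  exact ⟨u, by rw [← hu]; simp⟩

/-- An endomorphism of a triangle that is the identity on both ends is unipotent. -/
theorem comp_two_sub_eq_id (hB : IsExtriangulated E s) {A X C : B} {x : A ⟶ X} {y : X ⟶ C}
    {δ : Ext E C A} (h : IsTriangle s x y δ) (φ : X ⟶ X) (hx : x ≫ φ = x) (hy : φ ≫ y = y) :
    φ ≫ (𝟙 X + 𝟙 X - φ) = 𝟙 X ∧ (𝟙 X + 𝟙 X - φ) ≫ φ = 𝟙 X := by
  -- φ - 1 factors through x and is killed by x, so it squares to zero and 2 - φ inverts φ.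
  obtain ⟨u, hu⟩ := hB.exists_factor h (φ - 𝟙 X) (by simp [hy])
  have hsq : (φ - 𝟙 X) ≫ (φ - 𝟙 X) = 0 := by
    nth_rw 1 [← hu]
    simp [hx]
  simp only [Preadditive.comp_sub, Preadditive.sub_comp, Preadditive.comp_add,
    Preadditive.add_comp, Category.id_comp, Category.comp_id] at hsq ⊢
  have key : φ + φ - φ ≫ φ - 𝟙 X = 0 := by
    rw [← neg_eq_zero, ← hsq]
    abel
  exact ⟨sub_eq_zero.mp key, sub_eq_zero.mp key⟩

/-- The transported extension has some realization G. The comparison maps between X and G need not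
be mutually inverse, but their composites are the identity on both ends, hence invertible by
`comp_two_sub_eq_id`; so X ≅ G. -/
theorem existsTriangle_of_iso (hB : IsExtriangulated E s) {A X C A' X' C' : B}
    (h : ExistsTriangle s A X C) (a : A ≅ A') (b : X ≅ X') (c : C ≅ C') :
    ExistsTriangle s A' X' C' := by
  obtain ⟨x, y, δ, h⟩ := h
  obtain ⟨G, x', y', hG⟩ := exists_isTriangle s (push E a.hom (pull E c.inv δ))
  obtain ⟨g, hgx, hgy⟩ := hB.realization h hG a.hom c.hom (by
    rw [push_pull, ← pull_comp, c.hom_inv_id, pull_id])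
  obtain ⟨g', hgx', hgy'⟩ := hB.realization hG h a.inv c.inv (by
    rw [← push_comp, a.hom_inv_id, push_id])
  obtain ⟨hr, -⟩ := hB.comp_two_sub_eq_id h (g ≫ g')
    (by rw [← Category.assoc, hgx, Category.assoc, hgx', a.hom_inv_id_assoc])
    (by rw [Category.assoc, ← hgy', ← Category.assoc, ← hgy, Category.assoc, c.hom_inv_id,
      Category.comp_id])
  obtain ⟨-, hl⟩ := hB.comp_two_sub_eq_id hG (g' ≫ g)
    (by rw [← Category.assoc, hgx', Category.assoc, hgx, a.inv_hom_id_assoc])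
    (by rw [Category.assoc, ← hgy, ← Category.assoc, ← hgy', Category.assoc, c.inv_hom_id,
      Category.comp_id])
  rw [Category.assoc] at hr
  rw [← Category.assoc] at hl
  have e : X ≅ G :=
    { hom := g
      inv := g' ≫ (𝟙 X + 𝟙 X - g ≫ g')
      hom_inv_id := hr
      inv_hom_id := by
        have : (𝟙 G + 𝟙 G - g' ≫ g) ≫ g' = g' ≫ (𝟙 X + 𝟙 X - g ≫ g') := by simp
        rw [← this, hl] }
  exact ⟨_, _, _, hG.of_iso_mid (e.symm ≪≫ b)⟩

theorem split_symm (hB : IsExtriangulated E s) (A C : B) :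
    IsTriangle s (biprod.inr : A ⟶ C ⊞ A) (biprod.fst : C ⊞ A ⟶ C) (0 : Ext E C A) := by
  have h := (hB.split A C).of_iso_mid (biprod.braiding A C)
  have h₁ : biprod.inl ≫ (biprod.braiding A C).hom = biprod.inr := by ext <;> simp
  have h₂ : (biprod.braiding A C).inv ≫ biprod.snd = biprod.fst := by ext <;> simp
  rwa [h₁, h₂] at h

/-- The pullback of two deflations with the same target. -/
theorem exists_pullback (hB : IsExtriangulated E s) {A₁ X₁ A₂ X₂ C : B}
    (h₁ : ExistsTriangle s A₁ X₁ C) (h₂ : ExistsTriangle s A₂ X₂ C) :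
    ∃ P : B, ExistsTriangle s A₁ P X₂ ∧ ExistsTriangle s A₂ P X₁ := by
  obtain ⟨x₁, y₁, δ₁, h₁⟩ := h₁
  obtain ⟨x₂, y₂, δ₂, h₂⟩ := h₂
  -- P realizes the extension of C by A₁ ⊞ A₂ with components δ₁ and δ₂. Dividing P by one summand
  -- leaves the realization of the other component.
  obtain ⟨P, i, p, hP⟩ := exists_isTriangle s
    (push E (biprod.inl : _ ⟶ A₁ ⊞ A₂) δ₁ + push E biprod.inr δ₂)
  have key : ∀ {S T Y : B} {u : S ⟶ A₁ ⊞ A₂} {q : A₁ ⊞ A₂ ⟶ T} {x : T ⟶ Y} {y : Y ⟶ C}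
      {δ : Ext E C T}, IsTriangle s u q (0 : Ext E T S) → IsTriangle s x y δ →
      push E (biprod.inl ≫ q) δ₁ + push E (biprod.inr ≫ q) δ₂ = δ → ExistsTriangle s S P Y := by
    intro S T Y u q x y δ hu hx hδ
    obtain ⟨H, h', d, e, ε, -, -, hε, he, -, -⟩ := hB.et4 hu hP
    rw [push_add, ← push_comp, ← push_comp, hδ] at he
    obtain ⟨b, -⟩ := he.exists_iso hx
    exact hB.existsTriangle_of_iso ⟨_, _, _, hε⟩ (Iso.refl _) (Iso.refl _) b
  refine ⟨P, key (hB.split A₁ A₂) h₂ ?_, key (u := biprod.inr) (q := biprod.fst) ?_ h₁ ?_⟩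
  · simp [hB.zero_push, push_id]
  · exact hB.split_symm A₂ A₁
  · simp [hB.zero_push, push_id]

/-- The pushout of two inflations with the same source. -/
theorem exists_pushout (hB : IsExtriangulated E s) {A X₁ C₁ X₂ C₂ : B}
    (h₁ : ExistsTriangle s A X₁ C₁) (h₂ : ExistsTriangle s A X₂ C₂) :
    ∃ P : B, ExistsTriangle s X₁ P C₂ ∧ ExistsTriangle s X₂ P C₁ := by
  obtain ⟨x₁, y₁, δ₁, h₁⟩ := h₁
  obtain ⟨x₂, y₂, δ₂, h₂⟩ := h₂
  obtain ⟨P, i, p, hP⟩ := exists_isTriangle s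
    (pull E (biprod.fst : C₁ ⊞ C₂ ⟶ _) δ₁ + pull E biprod.snd δ₂)
  have key : ∀ {S T Y : B} {u : S ⟶ C₁ ⊞ C₂} {q : C₁ ⊞ C₂ ⟶ T} {x : A ⟶ Y} {y : Y ⟶ S}
      {δ : Ext E S A}, IsTriangle s u q (0 : Ext E T S) → IsTriangle s x y δ →
      pull E (u ≫ biprod.fst) δ₁ + pull E (u ≫ biprod.snd) δ₂ = δ → ExistsTriangle s Y P T := by
    intro S T Y u q x y δ hu hx hδ
    obtain ⟨H, h', d, e, ε, -, -, hε, he, -, -⟩ := hB.et4_op hP hu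
    rw [pull_add, ← pull_comp, ← pull_comp, hδ] at he
    obtain ⟨b, -⟩ := he.exists_iso hx
    exact hB.existsTriangle_of_iso ⟨_, _, _, hε⟩ b (Iso.refl _) (Iso.refl _)
  refine ⟨P, key (hB.split C₁ C₂) h₁ ?_, key (u := biprod.inr) (q := biprod.fst) ?_ h₂ ?_⟩
  · simp [hB.zero_pull, pull_id]
  · exact hB.split_symm C₂ C₁
  · simp [hB.zero_pull, pull_id]

/-- The vanishing of second extensions of `P` by `Q` for a complete cotorsion pair `(P, Q)` with `P`
closed under cocones: every `θ ∈ 𝔼(T, Z)` with `P T` lifts along a deflation onto `Z` whose cocone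
is in `Q`. -/
theorem exists_lift_ext (hB : IsExtriangulated E s) {P Q : ObjectProperty B}
    (hPQ : IsCompleteCotorsionPair s P Q) (hP : ClosedUnderCocones s P) {A X Z T : B} {x : A ⟶ X}
    {y : X ⟶ Z} {δ : Ext E Z A} (h : IsTriangle s x y δ) (hA : Q A) (hT : P T) (θ : Ext E T Z) :
    ∃ θ' : Ext E T X, push E y θ' = θ := by
  obtain ⟨G, i, p, hG⟩ := exists_isTriangle s θ
  obtain ⟨N, D, -, hD, x', y', ε, hε⟩ := hPQ.precover G
  obtain ⟨H, h', d, e, θ', -, -, hθ', -, he, -⟩ := hB.et4_op hε hG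
  -- H is the cocone of the composite D → T, so closure under cocones gives 𝔼(H, A) = 0, and e : H →
  -- Z lifts to X.
  have hH : P H := hP _ _ _ ⟨_, _, _, hθ'⟩ hD hT
  rw [← hPQ.leftPerp_eq] at hH
  obtain ⟨g, hg⟩ := hB.exists_lift h e (hH A hA _)
  exact ⟨push E g θ', by rw [← push_comp, hg, he]⟩

theorem rightPerp_of_triangle_isZero (hB : IsExtriangulated E s) {P : ObjectProperty B} {M Y Z : B}
    (h : ExistsTriangle s M Y Z) (hY : rightPerp E P Y) (hZ : IsZero Z) : rightPerp E P M := by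
  obtain ⟨x, y, δ, h⟩ := h
  intro T hT ξ
  obtain ⟨c, rfl⟩ := hB.exists_pull_eq h ξ (hY T hT _)
  rw [hZ.eq_of_tgt c 0, hB.zero_pull]

/-- If `Z` has a one-step coresolution `Z ⟶ G ⟶ T` with `Q G` and `P T`, then so does every
extension of `Z` by an object of `Q`, with the same cone `T`. -/
theorem exists_triangle_of_extension (hB : IsExtriangulated E s) {P Q : ObjectProperty B}
    (hPQ : IsCompleteCotorsionPair s P Q) (hP : ClosedUnderCocones s P) {A X Z G T : B}
    (h : ExistsTriangle s A X Z) (hA : Q A) (h' : ExistsTriangle s Z G T) (hG : Q G) (hT : P T) :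
    ∃ R : B, Q R ∧ ExistsTriangle s X R T := by
  obtain ⟨x, y, δ, h⟩ := h
  obtain ⟨i, p, θ, h'⟩ := h'
  obtain ⟨θ', rfl⟩ := hB.exists_lift_ext hPQ hP h hA hT θ
  obtain ⟨R, j, q, hR⟩ := exists_isTriangle s θ'
  obtain ⟨H, k, d, e, ε, -, -, hε, he, -, -⟩ := hB.et4 h hR
  obtain ⟨b, -⟩ := he.exists_iso h'
  have hAR := hB.existsTriangle_of_iso ⟨_, _, _, hε⟩ (Iso.refl _) (Iso.refl _) b
  rw [← hPQ.rightPerp_eq] at hA hG ⊢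
  exact ⟨R, hB.rightPerp_extension _ _ _ _ hAR hA hG, _, _, _, hR⟩

end IsExtriangulated

end Extri

namespace Extri

/-! ### Finite coresolutions as iterated conflations. -/

section Coresolution

variable {B : Type u} [Category.{v} B] {E : Bᵒᵖ ⥤ B ⥤ AddCommGrpCat.{w}} {s : Correspondence E}

/-- Prepend a conflation `M ⟶ Y ⟶ Z` to a coresolution of `Z`. -/
def Coresolution.cons {Q : ObjectProperty B} {M Y Z : B} (hY : Q Y) {x : M ⟶ Y} {y : Y ⟶ Z}
    (h : IsConflation s x y) (R : Coresolution s Q Z) : Coresolution s Q M where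
  Y := fun k => Nat.rec Y (fun k _ => R.Y k) k
  Z := fun k => Nat.rec Z (fun k _ => R.Z k) k
  mem := fun k => match k with
    | 0 => hY
    | k + 1 => R.mem k
  aug := x
  proj := fun k => match k with
    | 0 => y
    | k + 1 => R.proj k
  inc := fun k => match k with
    | 0 => R.aug
    | k + 1 => R.inc k
  conflation_zero := h
  conflation_succ := fun k => match k with
    | 0 => R.conflation_zero
    | k + 1 => R.conflation_succ k

theorem Coresolution.HasLength.cons {Q : ObjectProperty B} {M Y Z : B} (hY : Q Y) {x : M ⟶ Y}
    {y : Y ⟶ Z} (h : IsConflation s x y) {R : Coresolution s Q Z} {n : ℕ} (hR : R.HasLength n) :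
    (Coresolution.cons hY h R).HasLength (n + 1) where
  isZero_term := fun k hk => match k, hk with
    | k + 1, hk => hR.isZero_term k (by omega)
  isZero_cycle := fun k hk => match k, hk with
    | k + 1, hk => hR.isZero_cycle k (by omega)

/-- Drop the first conflation of a coresolution. -/
def Coresolution.tail {Q : ObjectProperty B} {M : B} (R : Coresolution s Q M) :
    Coresolution s Q (R.Z 0) where
  Y := fun k => R.Y (k + 1)
  Z := fun k => R.Z (k + 1)
  mem := fun k => R.mem (k + 1)
  aug := R.inc 0
  proj := fun k => R.proj (k + 1)
  inc := fun k => R.inc (k + 1)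
  conflation_zero := R.conflation_succ 0
  conflation_succ := fun k => R.conflation_succ (k + 1)

theorem Coresolution.HasLength.tail {Q : ObjectProperty B} {M : B} {R : Coresolution s Q M} {n : ℕ}
    (hR : R.HasLength (n + 1)) : R.tail.HasLength n where
  isZero_term := fun k hk => hR.isZero_term (k + 1) (by omega)
  isZero_cycle := fun k hk => hR.isZero_cycle (k + 1) (by omega)

theorem coresDimLE_succ_iff (s : Correspondence E) (Q : ObjectProperty B) (n : ℕ) (M : B) :
    coresDimLE s Q (n + 1) M ↔
      ∃ Y Z : B, Q Y ∧ coresDimLE s Q n Z ∧ ExistsTriangle s M Y Z := by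
  rw [coresDimLE_iff]
  constructor
  · rintro ⟨R, hR⟩
    exact ⟨R.Y 0, R.Z 0, R.mem 0, (coresDimLE_iff _ _ _ _).2 ⟨R.tail, hR.tail⟩, _, _,
      R.conflation_zero⟩
  · rintro ⟨Y, Z, hY, hZ, x, y, h⟩
    obtain ⟨R, hR⟩ := (coresDimLE_iff _ _ _ _).1 hZ
    exact ⟨.cons hY h R, hR.cons hY h⟩

theorem coresDimLE_of_le {s : Correspondence E} {Q : ObjectProperty B} {m n : ℕ} (h : m ≤ n) {M : B}
    (hM : coresDimLE s Q m M) : coresDimLE s Q n M :=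
  le_trans (show coresDim s Q M ≤ m from hM) (by exact_mod_cast h)

theorem coresDimLE_mono {P Q : ObjectProperty B} (h : P ≤ Q) (n : ℕ) :
    coresDimLE s P n ≤ coresDimLE s Q n := fun M hM => by
  obtain ⟨R, hR⟩ := (coresDimLE_iff _ _ _ _).1 hM
  exact (coresDimLE_iff _ _ _ _).2 ⟨{ R with mem := fun k => h _ (R.mem k) },
    ⟨hR.isZero_term, hR.isZero_cycle⟩⟩

end Coresolution

namespace IsExtriangulated

variable {B : Type u} [Category.{v} B] [Preadditive B] [HasZeroObject B] [HasBinaryBiproducts B]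
  {E : Bᵒᵖ ⥤ B ⥤ AddCommGrpCat.{w}} {s : Correspondence E}

/-- A coresolution of length 0 only provides M → Y₀ → 0. A right orthogonal class contains zero
objects and contains M along with Y₀; an arbitrary class need do neither. -/
theorem coresDimLE_zero_iff (hB : IsExtriangulated E s) (P : ObjectProperty B) (M : B) :
    coresDimLE s (rightPerp E P) 0 M ↔ rightPerp E P M := by
  rw [coresDimLE_iff]
  constructor
  · rintro ⟨R, hR⟩
    exact hB.rightPerp_of_triangle_isZero ⟨_, _, R.conflation_zero⟩ (R.mem 0)
      (hR.isZero_cycle 0 le_rfl)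
  · intro hM
    obtain ⟨Z, hZ⟩ := HasZeroObject.zero (C := B)
    -- The triangle Z → Z → Z on a zero object fills the infinite tail.
    obtain ⟨x₀, y₀, h₀⟩ := hB.existsTriangle_zero Z hZ
    obtain ⟨x, y, h⟩ := hB.existsTriangle_zero M hZ
    exact ⟨.cons hM h ⟨fun _ => Z, fun _ => Z, fun _ => hB.rightPerp_of_isZero P hZ, x₀,
      fun _ => y₀, fun _ => x₀, h₀, fun _ => h₀⟩,
      ⟨fun k hk => match k, hk with | k + 1, _ => hZ, fun k _ => by cases k <;> exact hZ⟩⟩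

theorem coresDimLE_iff_pred (hB : IsExtriangulated E s) (P : ObjectProperty B) (n : ℕ) (M : B) :
    coresDimLE s (rightPerp E P) n M ↔
      ∃ Y Z : B, rightPerp E P Y ∧ coresDimLEPred s (rightPerp E P) n Z ∧
        ExistsTriangle s M Y Z := by
  cases n with
  | zero =>
    rw [hB.coresDimLE_zero_iff]
    constructor
    · intro hM
      obtain ⟨Z, hZ⟩ := HasZeroObject.zero (C := B)
      exact ⟨M, Z, hM, hZ, hB.existsTriangle_zero M hZ⟩
    · rintro ⟨Y, Z, hY, hZ, h⟩
      exact hB.rightPerp_of_triangle_isZero h hY hZ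
  | succ n => exact coresDimLE_succ_iff s _ n M

theorem coresDimLE_of_iso (hB : IsExtriangulated E s) {P : ObjectProperty B} {n : ℕ} {M N : B}
    (e : M ≅ N) (hM : coresDimLE s (rightPerp E P) n M) : coresDimLE s (rightPerp E P) n N := by
  obtain ⟨Y, Z, hY, hZ, h⟩ := (hB.coresDimLE_iff_pred P n M).1 hM
  exact (hB.coresDimLE_iff_pred P n N).2
    ⟨Y, Z, hY, hZ, hB.existsTriangle_of_iso h e (Iso.refl _) (Iso.refl _)⟩

/-! ### Closure properties of 𝒬ₙ for a cotorsion pair. -/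

section CotorsionPair

variable {P Q : ObjectProperty B}

/-- The two properties need a joint induction: both at n give the dimension shift `cone`, which in
turn gives each of them at n + 1. -/
theorem coresDimLE_summand_and_extension (hB : IsExtriangulated E s)
    (hPQ : IsCompleteCotorsionPair s P Q) (hP : ClosedUnderCocones s P) (n : ℕ) :
    (∀ M N : B, coresDimLE s Q n (M ⊞ N) → coresDimLE s Q n N) ∧
      ∀ A X Z : B, ExistsTriangle s A X Z → Q A → coresDimLE s Q n Z → coresDimLE s Q n X := by
  have hQ := hPQ.rightPerp_eq
  have hP' := hPQ.leftPerp_eq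
  induction n with
  | zero =>
    simp only [← hQ, hB.coresDimLE_zero_iff]
    exact ⟨fun M N h => rightPerp_of_retract biprod.inr biprod.snd (by simp) h,
      hB.rightPerp_extension P⟩
  | succ n ih =>
    obtain ⟨ihS, ihE⟩ := ih
    have cone : ∀ M G T : B, ExistsTriangle s M G T → Q G → P T → coresDimLE s Q (n + 1) M →
        coresDimLE s Q n T := by
      intro M G T h hG hT hM
      obtain ⟨Y, Z, hY, hZ, h'⟩ := (coresDimLE_succ_iff s Q n M).1 hM
      -- R is an extension of Z by G, so it has dimension at most n. The other conflation Y → R → T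
      -- splits because 𝔼(T, Y) = 0, making T a summand of R.
      obtain ⟨R, hR, x, y, δ, hR'⟩ := hB.exists_pushout h h'
      have hRn := ihE _ _ _ hR hG hZ
      rw [← hP'] at hT
      obtain rfl := hT Y hY δ
      obtain ⟨e⟩ := hB.exists_iso_biprod hR'
      refine ihS Y T ?_
      rw [← hQ] at hRn ⊢
      exact hB.coresDimLE_of_iso e hRn
    constructor
    · intro M N h
      obtain ⟨G, T, hG, hT, x, y, δ, h₁⟩ := hPQ.preenvelope M
      obtain ⟨G', T', hG', hT', x', y', δ', h₂⟩ := hPQ.preenvelope N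
      refine (coresDimLE_succ_iff s Q n N).2 ⟨G', T', hG', ihS T T' ?_, _, _, _, h₂⟩
      -- The sum of the two preenvelopes starts at M ⊞ N, so `cone` bounds the dimension of T ⊞ T'.
      refine cone _ _ _ ⟨_, _, _, hB.sum h₁ h₂⟩ ?_ ?_ h
      · rw [← hQ] at hG hG' ⊢
        exact hB.rightPerp_biprod hG hG'
      · rw [← hP'] at hT hT' ⊢
        exact hB.leftPerp_biprod hT hT'
    · intro A X Z h hA hZ
      obtain ⟨G, T, hG, hT, h'⟩ := hPQ.preenvelope Z
      obtain ⟨R, hR, hXR⟩ := hB.exists_triangle_of_extension hPQ hP h hA h' hG hT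
      exact (coresDimLE_succ_iff s Q n X).2 ⟨R, T, hR, cone _ _ _ h' hG hT hZ, hXR⟩

theorem coresDimLE_of_biprod (hB : IsExtriangulated E s) (hPQ : IsCompleteCotorsionPair s P Q)
    (hP : ClosedUnderCocones s P) {n : ℕ} {M N : B} (h : coresDimLE s Q n (M ⊞ N)) :
    coresDimLE s Q n M := by
  refine (hB.coresDimLE_summand_and_extension hPQ hP n).1 N M ?_
  rw [← hPQ.rightPerp_eq] at h ⊢
  exact hB.coresDimLE_of_iso (biprod.braiding M N) h

end CotorsionPair

end IsExtriangulated

theorem IsThick.coresDimLE_le {B : Type u} [Category.{v} B] [Preadditive B] [HasZeroObject B]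
    [HasBinaryBiproducts B] {E : Bᵒᵖ ⥤ B ⥤ AddCommGrpCat.{w}} {s : Correspondence E}
    {W Q : ObjectProperty B} (hB : IsExtriangulated E s) (hW : IsThick s W) (hQ : Q ≤ W) (n : ℕ) :
    coresDimLE s Q n ≤ W := by
  intro M hM
  obtain ⟨R, hR⟩ := (coresDimLE_iff _ _ _ _).1 hM
  clear hM
  induction n generalizing M with
  | zero =>
    refine hW.cocones _ _ _ ⟨_, _, R.conflation_zero⟩ (hQ _ (R.mem 0)) ?_
    -- The zero object Z₀ is in 𝒲 as the cone of Y₀ = Y₀.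
    have h0 := hR.isZero_cycle 0 le_rfl
    refine hW.cones _ _ _ ?_ (hQ _ (R.mem 0)) (hQ _ (R.mem 0))
    exact hB.existsTriangle_zero _ h0
  | succ n ih =>
    exact hW.cocones _ _ _ ⟨_, _, R.conflation_zero⟩ (hQ _ (R.mem 0)) (ih _ R.tail hR.tail)

/-! ### The four conditions for a hereditary Hovey triple. -/

namespace IsHereditaryHoveyTriple

variable {B : Type u} [Category.{v} B] [Preadditive B] [HasZeroObject B] [HasBinaryBiproducts B]
  {E : Bᵒᵖ ⥤ B ⥤ AddCommGrpCat.{w}} {s : Correspondence E} {C W F : ObjectProperty B}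

/-- A precover from 𝒞 ∩ 𝒲 suffices: its middle term is an extension of M by N, both in ℱ. -/
theorem exists_trivFib_resolution (h : IsHereditaryHoveyTriple s C W F) (hB : IsExtriangulated E s)
    {M : B} (hM : F M) : ∃ N L : B, F N ∧ (W ⊓ F) L ∧ ExistsTriangle s N L M := by
  obtain ⟨N, L, hN, hL, hNL⟩ := h.trivCof.precover M
  refine ⟨N, L, hN, ⟨hL.2, ?_⟩, hNL⟩
  rw [← h.trivCof.rightPerp_eq] at hN hM ⊢
  exact hB.rightPerp_extension _ _ _ _ hNL hN hM

theorem coresDimLE_trivFib_iff (h : IsHereditaryHoveyTriple s C W F) (hB : IsExtriangulated E s)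
    (n : ℕ) (M : B) : coresDimLE s (W ⊓ F) n M ↔
      ∃ Y Z : B, (W ⊓ F) Y ∧ coresDimLEPred s (W ⊓ F) n Z ∧ ExistsTriangle s M Y Z := by
  rw [← h.trivFib.rightPerp_eq]
  exact hB.coresDimLE_iff_pred C n M

theorem exists_resolution_iff_exists_coresolution (h : IsHereditaryHoveyTriple s C W F)
    (hB : IsExtriangulated E s) (M : B) (n : ℕ) :
    (∃ N L : B, F N ∧ coresDimLE s (W ⊓ F) n L ∧ ExistsTriangle s N L M) ↔
      ∃ G K : B, F G ∧ coresDimLEPred s (W ⊓ F) n K ∧ ExistsTriangle s M G K := by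
  constructor
  · rintro ⟨N, L, hN, hL, x, y, δ, hNL⟩
    obtain ⟨Y, K, hY, hK, i, p, ε, hLY⟩ := (h.coresDimLE_trivFib_iff hB n L).1 hL
    obtain ⟨G, g, d, e, ζ, -, -, hNY, hMG, -, -⟩ := hB.et4 hNL hLY
    exact ⟨G, K, h.hereditary_trivCof.cones _ _ _ ⟨_, _, _, hNY⟩ hN hY.2, hK, _, _, _, hMG⟩
  · rintro ⟨G, K, hG, hK, i, p, ε, hGK⟩
    obtain ⟨N, L, hN, hL, x, y, δ, hNL⟩ := h.exists_trivFib_resolution hB hG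
    obtain ⟨H, g, d, e, ζ, -, -, hHL, hNH, -, -⟩ := hB.et4_op hNL hGK
    exact ⟨N, H, hN, (h.coresDimLE_trivFib_iff hB n H).2 ⟨L, K, hL, hK, _, _, _, hHL⟩,
      _, _, _, hNH⟩

theorem coresDimLE_iff_exists_coresolution (h : IsHereditaryHoveyTriple s C W F)
    (hB : IsExtriangulated E s) (M : B) (n : ℕ) :
    coresDimLE s F n M ↔
      ∃ G K : B, F G ∧ coresDimLEPred s (W ⊓ F) n K ∧ ExistsTriangle s M G K := by
  have hF := h.trivCof.rightPerp_eq
  constructor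
  · induction n generalizing M with
    | zero =>
      intro hM
      rw [← hF, hB.coresDimLE_iff_pred] at hM
      rwa [← hF]
    | succ n ih =>
      intro hM
      obtain ⟨Y, Z, hY, hZ, hMY⟩ := (coresDimLE_succ_iff s F n M).1 hM
      obtain ⟨N, L, hN, hL, hNL⟩ :=
        (h.exists_resolution_iff_exists_coresolution hB Z n).2 (ih Z hZ)
      obtain ⟨P, hMP, hNP⟩ := hB.exists_pullback hMY hNL
      refine ⟨P, L, ?_, hL, hMP⟩
      rw [← hF] at hN hY ⊢
      exact hB.rightPerp_extension _ _ _ _ hNP hN hY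
  · rintro ⟨G, K, hG, hK, hGK⟩
    rw [← hF, hB.coresDimLE_iff_pred, hF]
    refine ⟨G, K, hG, ?_, hGK⟩
    cases n with
    | zero => exact hK
    | succ n => exact coresDimLE_mono inf_le_right n _ hK

theorem coresDimLE_iff_exists_resolution (h : IsHereditaryHoveyTriple s C W F)
    (hB : IsExtriangulated E s) (M : B) (n : ℕ) :
    coresDimLE s F n M ↔
      ∃ N L : B, F N ∧ coresDimLE s (W ⊓ F) n L ∧ ExistsTriangle s N L M :=
  (h.coresDimLE_iff_exists_coresolution hB M n).trans
    (h.exists_resolution_iff_exists_coresolution hB M n).symm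

/-- Since 𝒲 ∩ ℱ lies in (𝒲 ∩ ℱ)ₙ, orthogonals reverse the inclusion. This places the test objects of
(4) in 𝒞 ∩ 𝒲, where `exists_lift_ext` applies. -/
theorem leftPerp_coresDimLE_le (h : IsHereditaryHoveyTriple s C W F) (hB : IsExtriangulated E s)
    (n : ℕ) : leftPerp E (coresDimLE s (W ⊓ F) n) ≤ C := by
  intro H hH
  rw [← h.trivFib.leftPerp_eq]
  intro Y hY
  refine hH Y (coresDimLE_of_le (Nat.zero_le n) ?_)
  rw [← h.trivFib.rightPerp_eq] at hY ⊢
  exact (hB.coresDimLE_zero_iff C Y).2 hY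

theorem ext_eq_zero_of_coresDimLE (h : IsHereditaryHoveyTriple s C W F)
    (hB : IsExtriangulated E s) {M H : B} {n : ℕ} (hM : coresDimLE s F n M)
    (hH : (leftPerp E (coresDimLE s (W ⊓ F) n) ⊓ W) H) (δ : Ext E H M) : δ = 0 := by
  obtain ⟨N, L, hN, hL, x, y, ε, hNL⟩ := (h.coresDimLE_iff_exists_resolution hB M n).1 hM
  obtain ⟨θ, rfl⟩ := hB.exists_lift_ext h.trivCof h.hereditary_trivCof.cocones hNL hN
    ⟨h.leftPerp_coresDimLE_le hB n _ hH.1, hH.2⟩ δ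
  rw [hH.1 L hL θ, push_zero]

theorem coresDimLE_of_ext_eq_zero (h : IsHereditaryHoveyTriple s C W F)
    (hB : IsExtriangulated E s) {M : B} {n : ℕ}
    (hV : IsCompleteCotorsionPair s (leftPerp E (coresDimLE s (W ⊓ F) n))
      (coresDimLE s (W ⊓ F) n))
    (hM : ∀ H : B, (leftPerp E (coresDimLE s (W ⊓ F) n) ⊓ W) H → ∀ δ : Ext E H M, δ = 0) :
    coresDimLE s F n M := by
  obtain ⟨N, X, hN, hX, x, y, δ, hNX⟩ := h.trivCof.precover M
  obtain ⟨L, U, hL, hU, i, p, ε, hXL⟩ := hV.preenvelope X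
  -- Thickness makes U a legitimate test object: X and L are both in 𝒲.
  have hUW : W U := h.thick.cones _ _ _ ⟨_, _, _, hXL⟩ hX.2
    (h.thick.coresDimLE_le hB inf_le_left n _ hL)
  obtain ⟨P, g, d, e, ζ, -, -, hNP, hMP, -, -⟩ := hB.et4 hNX hXL
  have hP : coresDimLE s F n P :=
    (h.coresDimLE_iff_exists_resolution hB P n).2 ⟨N, L, hN, hL, _, _, _, hNP⟩
  -- The conflation M → P → U realizes an element of 𝔼(U, M) = 0, so it splits.
  rw [hM U ⟨hU, hUW⟩ (push E y ε)] at hMP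
  obtain ⟨b⟩ := hB.exists_iso_biprod hMP
  refine hB.coresDimLE_of_biprod h.trivCof h.hereditary_trivCof.cocones (N := U) ?_
  rw [← h.trivCof.rightPerp_eq] at hP ⊢
  exact hB.coresDimLE_of_iso b hP

end IsHereditaryHoveyTriple

end Extri

theorem theorem3p2 {B : Type u} [Category.{v} B] [Preadditive B]
    [HasZeroObject B] [HasBinaryBiproducts B]
    (E : Bᵒᵖ ⥤ B ⥤ AddCommGrpCat.{w}) (s : Extri.Correspondence E)
    (hB : Extri.IsExtriangulated E s) (hWIC : Extri.IsWIC s)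
    (C W F : ObjectProperty B) (hCWF : Extri.IsHereditaryHoveyTriple s C W F)
    (M : B) (n : ℕ) :
    (Extri.coresDimLE s F n M ↔
      ∃ N L : B, F N ∧ Extri.coresDimLE s (W ⊓ F) n L ∧ Extri.ExistsTriangle s N L M) ∧
    (Extri.coresDimLE s F n M ↔
      ∃ G K : B, F G ∧ Extri.coresDimLEPred s (W ⊓ F) n K ∧ Extri.ExistsTriangle s M G K) ∧
    (Extri.coresDimLE s F n M →
      ∀ H : B, (Extri.leftPerp E (Extri.coresDimLE s (W ⊓ F) n) ⊓ W) H →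
        ∀ δ : Extri.Ext E H M, δ = 0) ∧
    (Extri.IsCompleteCotorsionPair s (Extri.leftPerp E (Extri.coresDimLE s (W ⊓ F) n))
        (Extri.coresDimLE s (W ⊓ F) n) →
      (∀ H : B, (Extri.leftPerp E (Extri.coresDimLE s (W ⊓ F) n) ⊓ W) H →
        ∀ δ : Extri.Ext E H M, δ = 0) →
      Extri.coresDimLE s F n M) :=
  ⟨hCWF.coresDimLE_iff_exists_resolution hB M n, hCWF.coresDimLE_iff_exists_coresolution hB M n,
    fun hM _ hH δ => hCWF.ext_eq_zero_of_coresDimLE hB hM hH δ,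
    fun hV hM => hCWF.coresDimLE_of_ext_eq_zero hB hV hM⟩
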